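/- A group $G$ is called capable if there is a group $K$ with $G \cong K/Z(K)$. Let $p$ be a prime and let $G$ be a noncyclic group of exponent $p$ and nilpotency class at most two such that $G/Z(G)$ and $[G,G]$ are finitely generated. Let $n$ be the rank (minimal number of generators) of $G/Z(G)$ and let $\ell$ be the rank of $[G,G]$. Then: (a) if $G$ is capable, then $$\ell \ge \frac{\sqrt{9+8n}-3}{2};$$ (b) if $$\ell > \binom{n}{2} - 2\sqrt{n},$$ then $G$ is capable. -/

import Mathlib

/-- A group `G` is capable if it is isomorphic to `K ⧸ Z(K)` for some group `K`. -/
def IsCapable.{u} (G : Type u) [Group G] : Prop :=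
  ∃ (K : Type u) (_ : Group K), Nonempty (G ≃* K ⧸ Subgroup.center K)

/-! Put F = ℤ/p, V = G/Z(G) and W = [G,G]. The commutator induces an alternating map β : V × V → W
whose values span W. Both parts go through Jacobi forms: bilinear φ : W × V → F for which the cyclic
sum of φ(β(x,y),z) vanishes.

If G ≅ K/Z(K), commutators of lifts to K pair W with V, with values in the p-torsion of Z(K). The
Hall–Witt identity is the Jacobi identity, and a nontrivial element of W lifts to a noncentral
element, so every w ≠ 0 has φ(w,·) ≠ 0 for some Jacobi form φ (`exists_isJacobi_of_mulEquiv`).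
Conversely, for p odd, such forms yield 2-cocycles on G. In the resulting central extension the
chosen central element stops being central, and combining all these extensions proves capability
(`isCapable_of_sq_lt`).

Part (a) becomes n ≤ l + C(l+1,2) (`finrank_le_of_forall_exists_isJacobi`). Fix x in the right
kernel of φ. Then φ(β(x,y),z) is symmetric in y and z, so forcing it to vanish costs only the
dimension of a space of symmetric forms. Cutting W down to 0 by successive Jacobi forms, starting
with one of maximal rank, bounds dim V.

For part (b), Jacobi forms are the functionals on W ⊗ V that kill the image of Λ³V. If all of them
vanish on w ⊗ V, then w ⊗ V lies in that image. Its preimages are alternating 3-tensors with slices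
in the preimage X of Fw in Λ²V. Such tensors form a space of dimension at most (dim X - 1)²/4
(`four_mul_finrank_altTensors_le`), which is less than n. -/

open Module in
theorem Submodule.finrank_le_finrank_range_add_finrank_inf_ker {F V M : Type*} [Field F]
    [AddCommGroup V] [Module F V] [FiniteDimensional F V] [AddCommGroup M] [Module F M]
    (U : Submodule F V) (f : V →ₗ[F] M) :
    finrank F U ≤ finrank F (LinearMap.range f) + finrank F (U ⊓ LinearMap.ker f : Submodule F V) := by
  have h1 := Submodule.finrank_sup_add_finrank_inf_eq U (LinearMap.ker f)
  have h2 := f.finrank_range_add_finrank_ker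
  have h3 := Submodule.finrank_le (U ⊔ LinearMap.ker f)
  omega

/-! ### Jacobi forms and the dimension bound behind (a) -/

section JacobiForms

open Module

variable {F V W : Type*} [Field F] [AddCommGroup V] [Module F V] [AddCommGroup W] [Module F W]

/-- A bilinear map `φ : W × V → F` satisfies the Jacobi identity relative to `β : V × V → W`. -/
def IsJacobi (β : V →ₗ[F] V →ₗ[F] W) (φ : W →ₗ[F] V →ₗ[F] F) : Prop :=
  ∀ x y z, φ (β x y) z + φ (β y z) x + φ (β z x) y = 0

/-- The vectors `x` for which `β x` takes values in `W'`. -/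
def Submodule.bilinColon (β : V →ₗ[F] V →ₗ[F] W) (W' : Submodule F W) : Submodule F V where
  carrier := {x | ∀ y, β x y ∈ W'}
  add_mem' hx hy z := by simpa using W'.add_mem (hx z) (hy z)
  zero_mem' z := by simp
  smul_mem' c x hx z := by simpa using W'.smul_mem c (hx z)

variable [FiniteDimensional F V]

theorem finrank_add_finrank_ker_flip (φ : W →ₗ[F] V →ₗ[F] F) :
    finrank F (LinearMap.range φ) + finrank F (LinearMap.ker φ.flip) = finrank F V := by
  rw [← Subspace.finrank_add_finrank_dualCoannihilator_eq (LinearMap.range φ)]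
  suffices h : LinearMap.ker φ.flip = (LinearMap.range φ).dualCoannihilator by rw [h]
  ext x
  simp only [LinearMap.mem_ker, Submodule.mem_dualCoannihilator, LinearMap.mem_range,
    forall_exists_index, forall_apply_eq_imp_iff]
  exact ⟨fun h w => by simpa using LinearMap.congr_fun h w, fun h => LinearMap.ext h⟩

variable [FiniteDimensional F W]

/-- Passing from `W'` to the part of `W'` killed by a Jacobi form `φ` lowers the dimension of
`bilinColon` by at most the rank of `φ` plus the dimension of a space of symmetric forms. -/
theorem finrank_bilinColon_le_add {β : V →ₗ[F] V →ₗ[F] W} (hβ : ∀ x y, β x y = -β y x)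
    {φ : W →ₗ[F] V →ₗ[F] F} (hφ : IsJacobi β φ) (W' : Submodule F W) (r : ℕ)
    (hr : r + finrank F (W' ⊓ LinearMap.ker φ : Submodule F W) = finrank F W') :
    finrank F (W'.bilinColon β) ≤ finrank F (LinearMap.range φ) + (r + 1).choose 2 +
      finrank F ((W' ⊓ LinearMap.ker φ).bilinColon β) := by
  -- Restricting to the right kernel of `φ` costs at most its rank.
  have h1 : finrank F (W'.bilinColon β) ≤ finrank F (LinearMap.range φ) +
      finrank F (W'.bilinColon β ⊓ LinearMap.ker φ.flip : Submodule F V) := by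
    have h1 := Submodule.finrank_le_finrank_range_add_finrank_inf_ker (W'.bilinColon β) φ.flip
    have h2 := φ.flip.finrank_range_add_finrank_ker
    have h3 := finrank_add_finrank_ker_flip φ
    omega
  have hψ := finrank_add_finrank_ker_flip (φ.domRestrict W')
  set Z := LinearMap.ker (φ.domRestrict W').flip with hZ
  have hker := (φ.domRestrict W').finrank_range_add_finrank_ker
  have hker2 : finrank F (LinearMap.ker (φ.domRestrict W')) =
      finrank F (W' ⊓ LinearMap.ker φ : Submodule F W) := by
    rw [← Submodule.finrank_map_subtype_eq, LinearMap.domRestrict, LinearMap.ker_comp,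
      Submodule.map_comap_subtype]
  obtain ⟨C, hC⟩ := Z.exists_isCompl
  have hdim := Submodule.finrank_add_eq_of_isCompl hC
  have hCr : finrank F C = r := by omega
  let e : Basis (Fin r) F C := finBasisOfFinrankEq F C hCr
  -- The form φ(β(x,·),·) will be symmetric and vanish on `Z`, which has codimension r, so its
  -- entries on unordered pairs of basis vectors of a complement determine it.
  let f : V →ₗ[F] (Sym2 (Fin r) → F) := LinearMap.pi fun s =>
    (φ.flip (e s.sup : V)).comp (β.flip (e s.inf : V))
  have h2 := Submodule.finrank_le_finrank_range_add_finrank_inf_ker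
    (W'.bilinColon β ⊓ LinearMap.ker φ.flip) f
  have h3 : finrank F (LinearMap.range f) ≤ (r + 1).choose 2 := by
    refine (Submodule.finrank_le _).trans ?_
    rw [finrank_fintype_fun_eq_card, Sym2.card, Fintype.card_fin]
  have h4 : (W'.bilinColon β ⊓ LinearMap.ker φ.flip) ⊓ LinearMap.ker f ≤
      (W' ⊓ LinearMap.ker φ).bilinColon β := by
    rintro x ⟨⟨hxW, hxφ⟩, hxf⟩
    have hx0 : ∀ w, φ w x = 0 := fun w => LinearMap.congr_fun hxφ w
    have hsymm : ∀ y z, φ (β x y) z = φ (β x z) y := by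
      intro y z
      have h := hφ x y z
      rw [hx0, hβ z x, map_neg, LinearMap.neg_apply] at h
      linear_combination h
    have hZ0 : ∀ y, ∀ z ∈ Z, φ (β x y) z = 0 := fun y z hz =>
      LinearMap.congr_fun hz (⟨β x y, hxW y⟩ : W')
    have hij : ∀ i j, φ (β x (e i)) (e j) = 0 := by
      intro i j
      have h : ∀ i j : Fin r, i ≤ j → φ (β x (e i)) (e j) = 0 := by
        intro i j hij
        have := congr_fun hxf s(i, j)
        simpa [f, hij] using this
      rcases le_total i j with hle | hle
      · exact h i j hle
      · rw [hsymm]; exact h j i hle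
    have hC0 : ∀ y ∈ C, ∀ z ∈ C, φ (β x y) z = 0 := by
      let b : C →ₗ[F] C →ₗ[F] F :=
        ((φ.comp (β x)).domRestrict C).compl₂ C.subtype
      have hb : b = 0 := LinearMap.ext_basis e e fun i j => by simpa [b] using hij i j
      intro y hy z hz
      have := LinearMap.congr_fun₂ hb ⟨y, hy⟩ ⟨z, hz⟩
      simpa [b] using this
    have hall : ∀ y z, φ (β x y) z = 0 := by
      intro y z
      have hy : y ∈ Z ⊔ C := by rw [hC.sup_eq_top]; trivial
      have hz : z ∈ Z ⊔ C := by rw [hC.sup_eq_top]; trivial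
      obtain ⟨y1, hy1, y2, hy2, rfl⟩ := Submodule.mem_sup.1 hy
      obtain ⟨z1, hz1, z2, hz2, rfl⟩ := Submodule.mem_sup.1 hz
      rw [map_add, hZ0 _ z1 hz1, hsymm, map_add, hZ0 _ y1 hy1, hsymm, hC0 _ hy2 _ hz2]
      simp
    exact fun y => ⟨hxW y, LinearMap.ext fun z => hall y z⟩
  have h5 := Submodule.finrank_mono h4
  omega

theorem choose_two_add_succ (a b : ℕ) :
    (a + b + 1).choose 2 = (a + 1).choose 2 + (b + 1).choose 2 + a * b := by
  have h : ∀ k : ℕ, ((k + 1).choose 2 : ℚ) = (k + 1) * k / 2 := fun k => by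
    rw [Nat.cast_choose_two]; push_cast; ring
  have : ((a + b + 1).choose 2 : ℚ) = (a + 1).choose 2 + (b + 1).choose 2 + a * b := by
    rw [h, h, h]; push_cast; ring
  exact_mod_cast this

/-- The Heineken–Nikolova bound, in terms of alternating maps. -/
theorem finrank_le_of_forall_exists_isJacobi {β : V →ₗ[F] V →ₗ[F] W}
    (hβ : ∀ x y, β x y = -β y x) (hnd : ∀ x, (∀ y, β x y = 0) → x = 0)
    (hJ : ∀ w ≠ 0, ∃ φ, IsJacobi β φ ∧ φ w ≠ 0) :
    finrank F V ≤ finrank F W + (finrank F W + 1).choose 2 := by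
  -- Maximal rank ρ bounds the rank cost of every later cut and makes the first cut remove ρ
  -- dimensions of W at once.
  obtain ⟨φ, hφ, hmax⟩ : ∃ φ, IsJacobi β φ ∧ ∀ ψ, IsJacobi β ψ →
      finrank F (LinearMap.range ψ) ≤ finrank F (LinearMap.range φ) := by
    let S := {ρ | ∃ φ, IsJacobi β φ ∧ finrank F (LinearMap.range φ) = ρ}
    have hS : BddAbove S := by
      refine ⟨finrank F W, ?_⟩
      rintro _ ⟨φ, -, rfl⟩
      exact φ.finrank_range_le
    have hne : S.Nonempty := ⟨_, 0, fun _ _ _ => by simp, rfl⟩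
    obtain ⟨φ, hφ, hρ⟩ := Nat.sSup_mem hne hS
    exact ⟨φ, hφ, fun ψ hψ => hρ ▸ le_csSup hS ⟨ψ, hψ, rfl⟩⟩
  set ρ := finrank F (LinearMap.range φ) with hρ
  have key : ∀ d, ∀ W' : Submodule F W, finrank F W' = d →
      finrank F (W'.bilinColon β) ≤ ρ * d + (d + 1).choose 2 := by
    intro d
    induction d using Nat.strong_induction_on with
    | _ d ih =>
      intro W' hd
      rcases eq_or_ne W' ⊥ with rfl | hW'
      · have : (⊥ : Submodule F W).bilinColon β = ⊥ := by
          rw [eq_bot_iff]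
          exact fun x hx => hnd x hx
        rw [this, finrank_bot]
        exact Nat.zero_le _
      · obtain ⟨w, hw, hw0⟩ := Submodule.exists_mem_ne_zero_of_ne_bot hW'
        obtain ⟨ψ, hψ, hψw⟩ := hJ w hw0
        have hlt : finrank F (W' ⊓ LinearMap.ker ψ : Submodule F W) < finrank F W' := by
          refine Submodule.finrank_lt_finrank_of_lt (lt_of_le_of_ne inf_le_left fun h => hψw ?_)
          have : w ∈ W' ⊓ LinearMap.ker ψ := (SetLike.ext_iff.1 h w).2 hw
          exact this.2
        obtain ⟨r, hr⟩ := Nat.exists_eq_add_of_lt hlt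
        have h1 := finrank_bilinColon_le_add hβ hψ W' (r + 1) (by omega)
        have h2 := ih _ (hd ▸ hlt) _ rfl
        have h3 := hmax ψ hψ
        set d' := finrank F (W' ⊓ LinearMap.ker ψ : Submodule F W)
        have hd' : d = (r + 1) + d' := by omega
        rw [hd', choose_two_add_succ]
        nlinarith [Nat.zero_le (ρ * r), Nat.zero_le ((r + 1) * d')]
  -- With d = dim W - ρ, the first cut and `key` total ρ + C(ρ+1,2) + ρd + C(d+1,2) = ρ + C(dim W +
  -- 1, 2), and ρ ≤ dim W.
  have h0 := φ.finrank_range_add_finrank_ker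
  have h1 := finrank_bilinColon_le_add hβ hφ ⊤ ρ (by rw [top_inf_eq, finrank_top]; exact h0)
  have h2 := key _ (⊤ ⊓ LinearMap.ker φ) rfl
  have h3 : (⊤ : Submodule F W).bilinColon β = ⊤ := by
    rw [eq_top_iff]; exact fun x _ y => trivial
  rw [h3, finrank_top, ← hρ] at h1
  rw [top_inf_eq] at h1 h2
  rw [← h0, ← hρ, choose_two_add_succ]
  nlinarith

end JacobiForms

/-! ### Alternating 3-tensors with slices in a given space -/

section AlternatingTensors

open Module

variable (F ι : Type*) [Field F]

/-- The alternating `ι × ι` matrices. -/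
def altMatrices : Submodule F (ι → ι → F) where
  carrier := {u | (∀ i j, u i j = -u j i) ∧ ∀ i, u i i = 0}
  add_mem' hu hv := ⟨fun i j => by simp [hu.1 i j, hv.1 i j, add_comm], fun i => by
    simp [hu.2 i, hv.2 i]⟩
  zero_mem' := by simp
  smul_mem' c u hu := ⟨fun i j => by simp [hu.1 i j], fun i => by simp [hu.2 i]⟩

variable {F ι}

/-- The alternating 3-tensors all of whose slices lie in `X`. -/
def altTensors (X : Submodule F (ι → ι → F)) : Submodule F (ι → ι → ι → F) where
  carrier := {η | (∀ k, η k ∈ X) ∧ (∀ i j k, η i j k = -η j i k) ∧ ∀ i j, η i i j = 0}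
  add_mem' hη hθ := ⟨fun k => X.add_mem (hη.1 k) (hθ.1 k), fun i j k => by
    simp [hη.2.1 i j k, hθ.2.1 i j k, add_comm], fun i j => by simp [hη.2.2 i j, hθ.2.2 i j]⟩
  zero_mem' := ⟨fun _ => X.zero_mem, by simp, by simp⟩
  smul_mem' c η hη := ⟨fun k => X.smul_mem c (hη.1 k), fun i j k => by simp [hη.2.1 i j k],
    fun i j => by simp [hη.2.2 i j]⟩

theorem finrank_altMatrices_le (n : ℕ) : finrank F (altMatrices F (Fin n)) ≤ n.choose 2 := by
  let S := {e : Sym2 (Fin n) // ¬e.IsDiag}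
  let f : altMatrices F (Fin n) →ₗ[F] S → F :=
    (LinearMap.pi fun s : S => (LinearMap.proj s.1.sup).comp (LinearMap.proj s.1.inf)).comp
      (altMatrices F (Fin n)).subtype
  have hf : Function.Injective f := by
    rw [← LinearMap.ker_eq_bot, eq_bot_iff]
    rintro ⟨u, hu⟩ h
    have h1 : ∀ i j, i < j → u i j = 0 := by
      intro i j hij
      have := congr_fun (LinearMap.mem_ker.1 h) ⟨s(i, j), by simpa using hij.ne⟩
      simpa [f, hij.le] using this
    refine Subtype.ext (funext₂ fun i j => ?_)
    rcases lt_trichotomy i j with h | rfl | h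
    · exact h1 i j h
    · exact hu.2 i
    · exact (hu.1 i j).trans (by rw [h1 j i h, neg_zero]; rfl)
  refine (LinearMap.finrank_le_finrank_of_injective hf).trans ?_
  rw [finrank_fintype_fun_eq_card, Sym2.card_subtype_not_diag, Fintype.card_fin]

/-- Induction on dim X. If the tensor space is nonzero, some index k has the property that the
matrices in X with zero k-th row form a subspace X₀ of codimension at least 2. The k-th slice of a
tensor lies in X₀, and a tensor whose k-th slice vanishes has all slices in X₀. With d₀ = dim X₀,
the bound follows from 4d₀ + (d₀ - 1)² = (d₀ + 1)² ≤ (dim X - 1)². -/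
theorem four_mul_finrank_altTensors_le [Finite ι] (X : Submodule F (ι → ι → F))
    (hX : X ≤ altMatrices F ι) :
    4 * (finrank F (altTensors X) : ℤ) ≤ ((finrank F X : ℤ) - 1) ^ 2 := by
  induction hd : finrank F X using Nat.strong_induction_on generalizing X with
  | _ d ih =>
    rcases eq_or_ne (altTensors X) ⊥ with h0 | h0
    · rw [h0, finrank_bot]; positivity
    obtain ⟨η, hη, hη0⟩ := Submodule.exists_mem_ne_zero_of_ne_bot h0
    obtain ⟨k, i, j, hkij⟩ : ∃ k i j, η k i j ≠ 0 := by
      by_contra! h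
      exact hη0 (funext fun k => funext₂ (h k))
    let p : (ι → ι → F) →ₗ[F] ι → F := LinearMap.proj k
    set X₀ := X ⊓ LinearMap.ker p with hX₀
    have hdrop : finrank F X₀ + 2 ≤ finrank F X := by
      -- The slices `η i` and `η j` have independent k-th rows: the first is zero at i and nonzero
      -- at j, the second nonzero at i.
      let g : X →ₗ[F] F × F :=
        (((LinearMap.proj i).comp p).prod ((LinearMap.proj j).comp p)).comp X.subtype
      have hg : Function.Surjective g := by
        rintro ⟨a, b⟩
        refine ⟨(b * (η i k j)⁻¹) • ⟨η i, hη.1 i⟩ + (a * (η j k i)⁻¹) • ⟨η j, hη.1 j⟩, ?_⟩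
        have h1 : η i k j ≠ 0 := by rw [hη.2.1]; exact neg_ne_zero.2 hkij
        have h2 : η j k i ≠ 0 := by
          rw [hη.2.1, (hX (hη.1 k)).1, neg_neg]; exact hkij
        have h3 : ∀ i, η i k i = 0 := fun i => by
          rw [(hX (hη.1 i)).1, hη.2.2, neg_zero]
        simp [g, p, h1, h2, h3]
      have h1 := g.finrank_range_add_finrank_ker
      rw [LinearMap.range_eq_top.2 hg, finrank_top, finrank_prod, finrank_self] at h1
      have h2 : finrank F X₀ ≤ finrank F (LinearMap.ker g) := by
        rw [← Submodule.finrank_map_subtype_eq]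
        refine Submodule.finrank_mono ?_
        rintro u ⟨hu, hu0⟩
        refine ⟨⟨u, hu⟩, ?_, rfl⟩
        have : u k = 0 := hu0
        simp [g, p, this]
      omega
    have hstep : finrank F (altTensors X) ≤ finrank F X₀ + finrank F (altTensors X₀) := by
      let q : (ι → ι → ι → F) →ₗ[F] ι → ι → F := LinearMap.proj k
      have h1 := (q.domRestrict (altTensors X)).finrank_range_add_finrank_ker
      have h2 : LinearMap.range (q.domRestrict (altTensors X)) ≤ X₀ := by
        rintro _ ⟨⟨θ, hθ⟩, rfl⟩
        exact ⟨hθ.1 k, funext fun j => hθ.2.2 k j⟩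
      have h3 : finrank F (LinearMap.ker (q.domRestrict (altTensors X))) ≤
          finrank F (altTensors X₀) := by
        rw [← Submodule.finrank_map_subtype_eq]
        refine Submodule.finrank_mono ?_
        rintro _ ⟨⟨θ, hθ⟩, h, rfl⟩
        have h0 : θ k = 0 := h
        exact ⟨fun i => ⟨hθ.1 i, funext fun j => by
          simp [p, hθ.2.1 i k j, h0]⟩, hθ.2⟩
      have := Submodule.finrank_mono h2
      omega
    have h1 := ih _ (by omega) X₀ (inf_le_left.trans hX) rfl
    rw [hd] at hdrop
    zify at hdrop hstep
    nlinarith [Int.natCast_nonneg (finrank F X₀)]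

end AlternatingTensors

/-! ### Existence of Jacobi forms for (b) -/

section ExistsJacobi

open Module

variable {F V W : Type*} [Field F] [AddCommGroup V] [Module F V] [AddCommGroup W] [Module F W]
  [FiniteDimensional F V] [FiniteDimensional F W]

/-- If the kernel of `Λ²V → W` is small, then every nonzero `w` is detected by a Jacobi form. -/
theorem exists_isJacobi_apply_ne_zero {β : V →ₗ[F] V →ₗ[F] W} (h2 : (2 : F) ≠ 0)
    (hβ : ∀ x, β x x = 0)
    (hspan : Submodule.span F {w | ∃ x y, β x y = w} = ⊤)
    {k : ℕ} (hk : (finrank F V).choose 2 ≤ finrank F W + k) (hlt : k ^ 2 < 4 * finrank F V)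
    {w : W} (hw : w ≠ 0) : ∃ φ, IsJacobi β φ ∧ φ w ≠ 0 := by
  set n := finrank F V
  let e := finBasis F V
  -- The factor 1/2 compensates for the double sum counting each unordered pair twice, so the matrix
  -- of x ∧ y is sent to `β x y`.
  let B : (Fin n → Fin n → F) →ₗ[F] W :=
    ∑ i, ∑ j, (LinearMap.toSpanSingleton F W ((2 : F)⁻¹ • β (e i) (e j))).comp
      ((LinearMap.proj j : (Fin n → F) →ₗ[F] F).comp (LinearMap.proj i))
  have hskew : ∀ x y, β x y = -β y x := by
    intro x y
    have h := hβ (x + y)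
    simp only [map_add, LinearMap.add_apply, hβ, zero_add, add_zero] at h
    exact eq_neg_of_add_eq_zero_right h
  let wedge : V → V → Fin n → Fin n → F := fun x y i j =>
    e.repr x i * e.repr y j - e.repr y i * e.repr x j
  have hBexp : ∀ x y, β x y = ∑ i, ∑ j, (e.repr x i * e.repr y j) • β (e i) (e j) := by
    intro x y
    conv_lhs => rw [← e.sum_repr x, ← e.sum_repr y]
    simp only [map_sum, LinearMap.sum_apply, map_smul, LinearMap.smul_apply, Finset.smul_sum,
      smul_smul]
    rw [Finset.sum_comm]
    simp only [mul_comm]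
  have hBw : ∀ x y, B (wedge x y) = β x y := by
    intro x y
    have h : B (wedge x y) = (2 : F)⁻¹ • (β x y - β y x) := by
      rw [hBexp x y, hBexp y x]
      simp only [← Finset.sum_sub_distrib, Finset.smul_sum, B, LinearMap.sum_apply]
      refine Finset.sum_congr rfl fun i _ => Finset.sum_congr rfl fun j _ => ?_
      simp [wedge, smul_smul, ← sub_smul]
      ring_nf
    rw [h, hskew y x, sub_neg_eq_add, ← two_smul F, smul_smul, inv_mul_cancel₀ h2, one_smul]
  have hwedge : ∀ x y, wedge x y ∈ altMatrices F (Fin n) := fun x y =>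
    ⟨fun i j => by simp only [wedge]; ring, fun i => by simp only [wedge]; ring⟩
  let Bx : altMatrices F (Fin n) →ₗ[F] W := B.comp (Submodule.subtype _)
  have hBx : LinearMap.range Bx = ⊤ := by
    rw [eq_top_iff, ← hspan, Submodule.span_le]
    rintro _ ⟨x, y, rfl⟩
    exact ⟨⟨wedge x y, hwedge x y⟩, hBw x y⟩
  -- the preimage of the line spanned by `w`
  let X := altMatrices F (Fin n) ⊓ (F ∙ w).comap B
  have hXdim : finrank F X + finrank F W ≤ n.choose 2 + 1 := by
    let q := (F ∙ w).mkQ.comp Bx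
    have hq : LinearMap.range q = ⊤ := by
      rw [LinearMap.range_comp, hBx, Submodule.map_top, Submodule.range_mkQ]
    have h3 := q.finrank_range_add_finrank_ker
    have h4 := (F ∙ w).finrank_quotient_add_finrank
    have h5 := finrank_altMatrices_le (F := F) n
    have h6 : finrank F X = finrank F (LinearMap.ker q) := by
      rw [← Submodule.finrank_map_subtype_eq, LinearMap.ker_comp, Submodule.ker_mkQ,
        Submodule.comap_comp, Submodule.map_comap_subtype]
    rw [hq, finrank_top] at h3
    rw [finrank_span_singleton hw] at h4
    omega
  -- Identifying W ⊗ V with Wⁿ, `J` is the image of Λ³V; functionals vanishing on it are Jacobi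
  -- forms.
  let Ψ : (Fin n → Fin n → Fin n → F) →ₗ[F] Fin n → W := B.compLeft (Fin n)
  let J := (altTensors (altMatrices F (Fin n))).map Ψ
  obtain ⟨v, hv⟩ : ∃ v : Fin n → F, (fun k => v k • w) ∉ J := by
    by_contra! h
    let L : (Fin n → F) →ₗ[F] Fin n → W := (LinearMap.toSpanSingleton F W w).compLeft (Fin n)
    have hL : Function.Injective L := fun a b hab => funext fun k =>
      smul_left_injective F hw (congr_fun hab k)
    have hLr : LinearMap.range L ≤ (altTensors X).map Ψ := by
      rintro _ ⟨v, rfl⟩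
      obtain ⟨η, hη, hηv⟩ := h v
      exact ⟨η, ⟨fun k => ⟨hη.1 k, Submodule.mem_span_singleton.2 ⟨v k, (congr_fun hηv k).symm⟩⟩,
        hη.2⟩, hηv⟩
    have h3 := Submodule.finrank_mono hLr
    rw [LinearMap.finrank_range_of_inj hL, finrank_fintype_fun_eq_card, Fintype.card_fin] at h3
    have h4 := Submodule.finrank_map_le Ψ (altTensors X)
    have h5 := four_mul_finrank_altTensors_le X inf_le_left
    -- Since dim X ≤ k + 1, the tensor bound gives 4n ≤ k². The case dim X = 0 is separate because
    -- squaring dim X - 1 ≤ k requires dim X ≥ 1.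
    zify at hXdim h3 h4 hk hlt
    rcases (Int.natCast_nonneg (finrank F X)).eq_or_lt with h6 | h6
    · rw [← h6] at h5
      have : (n : ℤ) = 0 := by linarith [Int.natCast_nonneg n]
      nlinarith [sq_nonneg (k : ℤ)]
    · nlinarith
  obtain ⟨f, hf, hJ⟩ := Submodule.exists_le_ker_of_notMem hv
  let φ : W →ₗ[F] V →ₗ[F] F := LinearMap.mk₂ F (fun w x => f fun k => e.repr x k • w)
    (fun a b x => by rw [← map_add]; congr 1; ext k; simp)
    (fun c a x => by rw [← map_smul]; congr 1; ext k; exact smul_comm _ _ _)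
    (fun a x y => by rw [← map_add]; congr 1; ext k; simp [add_smul])
    (fun c a x => by rw [← map_smul]; congr 1; ext k; simp [mul_smul])
  have hφ : ∀ a x, φ a x = f fun k => e.repr x k • a := fun _ _ => rfl
  refine ⟨φ, fun x y z => ?_, fun h => hf ?_⟩
  -- This is x ∧ y ∧ z; its image under `Ψ` is the cyclic sum of β(x,y) ⊗ z.
  · let η : Fin n → Fin n → Fin n → F := fun k => e.repr z k • wedge x y +
      e.repr x k • wedge y z + e.repr y k • wedge z x
    have hη : η ∈ altTensors (altMatrices F (Fin n)) := by
      refine ⟨fun k => ?_, fun i j k => ?_, fun i j => ?_⟩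
      · exact add_mem (add_mem (Submodule.smul_mem _ _ (hwedge _ _))
          (Submodule.smul_mem _ _ (hwedge _ _))) (Submodule.smul_mem _ _ (hwedge _ _))
      · simp [η, wedge]; ring
      · simp [η, wedge]; ring
    have h := hJ ⟨η, hη, rfl⟩
    rw [LinearMap.mem_ker] at h
    rw [hφ, hφ, hφ, ← map_add, ← map_add, ← h]
    congr 1
    ext k
    simp [Ψ, η, hBw]
  · have := LinearMap.congr_fun h (e.equivFun.symm v)
    rw [hφ] at this
    have hv : ∀ k, e.repr (e.equivFun.symm v) k = v k := fun k => by
      rw [← Basis.equivFun_apply, LinearEquiv.apply_symm_apply]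
    simpa only [hv, LinearMap.zero_apply] using this

end ExistsJacobi

/-! ### Trilinear Jacobi cochains are coboundaries -/

section Coboundary

/-- Summing the cyclic identity would only give three times the claim, which is useless when p = 3.
Grouping by increasing triples avoids the division: the six permutations of each triple contribute
two cyclic sums. -/
theorem sum_eq_zero_of_symm_of_cyclic {ι M : Type*} [Fintype ι] [LinearOrder ι] [AddCommGroup M]
    (d : ι → ι → ι → M) (hswap : ∀ i j k, d i j k = d j i k) (h12 : ∀ i k, d i i k = 0)
    (h23 : ∀ i j, d i j j = 0) (hcyc : ∀ i j k, d i j k + d j k i + d k i j = 0) :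
    ∑ i, ∑ j, ∑ k, d i j k = 0 := by
  have h13 : ∀ i j, d i j i = 0 := fun i j => by rw [hswap, h23]
  let T : (ι → ι → ι → M) → M := fun g => ∑ i, ∑ j, ∑ k, g i j k
  have T12 : ∀ g, T (fun i j k => g j i k) = T g := fun g => Finset.sum_comm
  have T23 : ∀ g, T (fun i j k => g i k j) = T g := fun g =>
    Finset.sum_congr rfl fun i _ => Finset.sum_comm
  let R : (ι → ι → ι → M) → ι → ι → ι → M := fun g i j k => if i < j ∧ j < k then g i j k else 0
  have hsplit : d = fun i j k => R d i j k + R (fun i j k => d i k j) i k j +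
      R (fun i j k => d j i k) j i k + R (fun i j k => d k i j) j k i +
      R (fun i j k => d j k i) k i j + R (fun i j k => d k j i) k j i := by
    funext i j k
    simp only [R]
    rcases lt_trichotomy i j with h1 | rfl | h1
    · rcases lt_trichotomy j k with h2 | rfl | h2
      · simp [h1, h2, h1.trans h2, h1.not_gt, h2.not_gt, (h1.trans h2).not_gt]
      · simp only [h23, ite_self, add_zero]
      · rcases lt_trichotomy i k with h3 | rfl | h3
        · simp [h1, h2, h3, h1.not_gt, h2.not_gt, h3.not_gt]
        · simp only [h13, ite_self, add_zero]
        · simp [h1, h2, h3, h1.not_gt, h2.not_gt, h3.not_gt]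
    · simp only [h12, ite_self, add_zero]
    · rcases lt_trichotomy j k with h2 | rfl | h2
      · rcases lt_trichotomy i k with h3 | rfl | h3
        · simp [h1, h2, h3, h1.not_gt, h2.not_gt, h3.not_gt]
        · simp only [h13, ite_self, add_zero]
        · simp [h1, h2, h3, h1.not_gt, h2.not_gt, h3.not_gt]
      · simp only [h23, ite_self, add_zero]
      · simp [h1, h2, h2.trans h1, h1.not_gt, h2.not_gt, (h2.trans h1).not_gt]
  have hadd : ∀ g g', T (fun i j k => g i j k + g' i j k) = T g + T g' := fun g g' => by
    simp only [T, Finset.sum_add_distrib]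
  change T d = 0
  rw [hsplit]
  simp only [hadd]
  rw [T23 (R fun i j k => d i k j), T12 (R fun i j k => d j i k),
    T12 (fun i j k => R (fun i j k => d k i j) i k j), T23 (R fun i j k => d k i j),
    T23 (fun i j k => R (fun i j k => d j k i) j i k), T12 (R fun i j k => d j k i),
    T12 (fun i j k => R (fun i j k => d k j i) k i j),
    T23 (fun i j k => R (fun i j k => d k j i) j i k), T12 (R fun i j k => d k j i)]
  simp only [← hadd]
  refine Finset.sum_eq_zero fun i _ => Finset.sum_eq_zero fun j _ => Finset.sum_eq_zero fun k _ => ?_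
  simp only [R]
  split_ifs
  · have h := hcyc i j k
    rw [hswap i k j, hswap j i k, hswap k j i]
    have : d i j k + d k i j + d i j k + d k i j + d j k i + d j k i =
      (d i j k + d j k i + d k i j) + (d i j k + d j k i + d k i j) := by abel
    rw [this, h, add_zero]
  · simp

open Module

variable {F V W : Type*} [Field F] [AddCommGroup V] [Module F V] [AddCommGroup W] [Module F W]

/-- The coboundary of a 2-cochain on the additive group `V`. -/
def coboundaryTwo (F V : Type*) [Field F] [AddCommGroup V] :
    (V → V → F) →ₗ[F] V → V → V → F where
  toFun q x y z := q y z - q (x + y) z + q x (y + z) - q x y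
  map_add' q q' := by ext; simp; ring
  map_smul' c q := by ext; simp; ring

/-- The product of three linear functionals in three separate variables. -/
def tripleProduct (f g h : V →ₗ[F] F) : V → V → V → F := fun x y z => f x * g y * h z

theorem tripleProduct_add_swap_left_mem (f g h : V →ₗ[F] F) :
    tripleProduct f g h + tripleProduct g f h ∈ LinearMap.range (coboundaryTwo F V) :=
  ⟨fun x y => -(f x * g x * h y), by ext; simp [coboundaryTwo, tripleProduct]; ring⟩

theorem tripleProduct_add_swap_right_mem (f g h : V →ₗ[F] F) :
    tripleProduct f g h + tripleProduct f h g ∈ LinearMap.range (coboundaryTwo F V) :=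
  ⟨fun x y => f x * g y * h y, by ext; simp [coboundaryTwo, tripleProduct]; ring⟩

/-- Modulo coboundaries a product of three functionals is alternating, as 2 is invertible. It is
therefore invariant under cyclic shifts, and the Jacobi identity cancels the basis expansion of
φ(β(x,y),z). -/
theorem exists_coboundaryTwo_eq [FiniteDimensional F V] (h2 : (2 : F) ≠ 0)
    {β : V →ₗ[F] V →ₗ[F] W} (hskew : ∀ x y, β x y = -β y x)
    {φ : W →ₗ[F] V →ₗ[F] F} (hφ : IsJacobi β φ) :
    ∃ q : V → V → F, ∀ x y z, φ (β x y) z = q y z - q (x + y) z + q x (y + z) - q x y := by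
  let e := finBasis F V
  let t := fun i j k => tripleProduct (e.coord i) (e.coord j) (e.coord k)
  let π := (LinearMap.range (coboundaryTwo F V)).mkQ
  have hπ1 : ∀ i j k, π (t i j k) = -π (t j i k) := fun i j k => by
    rw [← add_eq_zero_iff_eq_neg, ← map_add, ← LinearMap.mem_ker, Submodule.ker_mkQ]
    exact tripleProduct_add_swap_left_mem _ _ _
  have hπ2 : ∀ i j k, π (t i j k) = -π (t i k j) := fun i j k => by
    rw [← add_eq_zero_iff_eq_neg, ← map_add, ← LinearMap.mem_ker, Submodule.ker_mkQ]
    exact tripleProduct_add_swap_right_mem _ _ _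
  have hself : ∀ u : (V → V → V → F) ⧸ LinearMap.range (coboundaryTwo F V), u = -u → u = 0 := by
    intro u hu
    have : (2 : F) • u = 0 := by rw [two_smul]; exact add_eq_zero_iff_eq_neg.2 hu
    exact (smul_eq_zero.1 this).resolve_left h2
  let b := fun i j k => φ (β (e i) (e j)) (e k)
  have hsum : ∑ i, ∑ j, ∑ k, b i j k • π (t i j k) = 0 := by
    apply sum_eq_zero_of_symm_of_cyclic fun i j k => b i j k • π (t i j k)
    · intro i j k
      simp only [b]
      rw [hskew, hπ1]
      simp
    · intro i k
      rw [hself _ (hπ1 i i k), smul_zero]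
    · intro i j
      rw [hself _ (hπ2 i j j), smul_zero]
    · intro i j k
      rw [hπ1 j k i, hπ2 k j i, hπ1 k i j, hπ2 i k j, neg_neg, neg_neg,
        ← add_smul, ← add_smul]
      simp only [b, hφ (e i) (e j) (e k), zero_smul]
  have hmem : (fun x y z => φ (β x y) z) ∈ LinearMap.range (coboundaryTwo F V) := by
    rw [← Submodule.ker_mkQ (LinearMap.range (coboundaryTwo F V)), LinearMap.mem_ker]
    rw [← hsum]
    simp only [← map_smul, ← map_sum, π]
    congr 1
    funext x y z
    conv_lhs => rw [← e.sum_repr x, ← e.sum_repr y, ← e.sum_repr z]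
    simp only [map_sum, LinearMap.sum_apply, map_smul, LinearMap.smul_apply, Finset.sum_apply,
      Pi.smul_apply, Finset.smul_sum, smul_smul]
    rw [Finset.sum_comm_cycle]
    refine Finset.sum_congr rfl fun i _ => ?_
    rw [Finset.sum_comm]
    refine Finset.sum_congr rfl fun j _ => Finset.sum_congr rfl fun k _ => ?_
    simp only [t, b, tripleProduct, Basis.coord_apply, smul_eq_mul]
    ring
  obtain ⟨q, hq⟩ := hmem
  exact ⟨q, fun x y z => congr_fun (congr_fun₂ hq.symm x y) z⟩

end Coboundary

/-! ### Central extensions from 2-cocycles -/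

section CocycleExtension

variable {G A : Type*} [Group G] [AddCommGroup A]

/-- 2-cocycles of `G` with values in the trivial module `A`. -/
def IsTwoCocycle (c : G → G → A) : Prop :=
  ∀ x y z, c x y + c (x * y) z = c y z + c x (y * z)

theorem IsTwoCocycle.one_left {c : G → G → A} (hc : IsTwoCocycle c) (x : G) : c 1 x = c 1 1 := by
  have h := hc 1 1 x
  rw [one_mul, one_mul] at h
  exact (add_right_cancel h).symm

theorem IsTwoCocycle.one_right {c : G → G → A} (hc : IsTwoCocycle c) (x : G) : c x 1 = c 1 1 := by
  have h := hc x 1 1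
  rw [mul_one, mul_one] at h
  exact add_right_cancel h

/-- The central extension of `G` by `A` defined by a 2-cocycle. -/
@[ext]
structure CocycleExtension (c : G → G → A) where
  base : G
  fiber : A

/-- The group structure on a central extension. -/
abbrev CocycleExtension.group {c : G → G → A} (hc : IsTwoCocycle c) :
    Group (CocycleExtension c) :=
  letI : Mul (CocycleExtension c) := ⟨fun x y => ⟨x.base * y.base, x.fiber + y.fiber + c x.base y.base⟩⟩
  letI : One (CocycleExtension c) := ⟨⟨1, -c 1 1⟩⟩
  letI : Inv (CocycleExtension c) := ⟨fun x => ⟨x.base⁻¹, -x.fiber - c x.base⁻¹ x.base - c 1 1⟩⟩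
  Group.ofLeftAxioms
    (fun x y z => by
      refine CocycleExtension.ext (mul_assoc _ _ _) ?_
      change x.fiber + y.fiber + c x.base y.base + z.fiber + c (x.base * y.base) z.base =
        x.fiber + (y.fiber + z.fiber + c y.base z.base) + c x.base (y.base * z.base)
      have h := hc x.base y.base z.base
      rw [← sub_eq_zero] at h ⊢
      rw [← h]
      abel)
    (fun x => by
      refine CocycleExtension.ext (one_mul _) ?_
      change -c 1 1 + x.fiber + c 1 x.base = x.fiber
      rw [hc.one_left x.base, add_right_comm]
      exact (congr_arg (· + x.fiber) (neg_add_cancel _)).trans (zero_add _))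
    (fun x => by
      refine CocycleExtension.ext (inv_mul_cancel _) ?_
      change -x.fiber - c x.base⁻¹ x.base - c 1 1 + x.fiber + c x.base⁻¹ x.base = -c 1 1
      abel)

/-- A group is capable if each nontrivial element either is not central or becomes noncentral in
some central extension. -/
theorem isCapable_of_exists_isTwoCocycle.{u} {G : Type u} [Group G] {A : Type} [AddCommGroup A]
    (h : ∀ g : G, g ≠ 1 → ∃ c : G → G → A, IsTwoCocycle c ∧
      ∃ x, g * x ≠ x * g ∨ c g x ≠ c x g) : IsCapable G := by
  have h' : ∀ g : G, ∃ c : G → G → A, IsTwoCocycle c ∧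
      (g ≠ 1 → ∃ x, g * x ≠ x * g ∨ c g x ≠ c x g) := by
    intro g
    by_cases hg : g = 1
    · exact ⟨0, fun x y z => by simp, fun h => (h hg).elim⟩
    · obtain ⟨c, hc, hx⟩ := h g hg
      exact ⟨c, hc, fun _ => hx⟩
  choose c hc hx using h'
  -- One extension carries the cocycles of all g as coordinates, so its center is exactly the kernel
  -- of the projection to G.
  let C : G → G → (G → A) := fun x y g => c g x y
  have hC : IsTwoCocycle C := fun x y z => funext fun g => hc g x y z
  let := CocycleExtension.group hC
  have mul_base : ∀ x y : CocycleExtension C, (x * y).base = x.base * y.base := fun _ _ => rfl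
  have mul_fiber : ∀ x y : CocycleExtension C,
    (x * y).fiber = x.fiber + y.fiber + C x.base y.base := fun _ _ => rfl
  let π : CocycleExtension C →* G := MonoidHom.mk' CocycleExtension.base mul_base
  have hπ : Function.Surjective π := fun g => ⟨⟨g, 0⟩, rfl⟩
  have hker : Subgroup.center (CocycleExtension C) = π.ker := by
    ext x
    rw [Subgroup.mem_center_iff, MonoidHom.mem_ker]
    constructor
    · intro hcen
      by_contra hne
      obtain ⟨y, hy | hy⟩ := hx x.base hne
      · exact hy (congr_arg CocycleExtension.base (hcen ⟨y, 0⟩)).symm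
      · have h1 := congr_fun (congr_arg CocycleExtension.fiber (hcen ⟨y, 0⟩)) x.base
        simp only [mul_fiber, zero_add, add_zero, Pi.add_apply, add_right_inj] at h1
        exact hy h1.symm
    · intro h1 y
      have h1 : x.base = 1 := h1
      refine CocycleExtension.ext ?_ ?_
      · rw [mul_base, mul_base, h1, mul_one, one_mul]
      · rw [mul_fiber, mul_fiber, h1, hC.one_left, hC.one_right]
        abel
  exact ⟨CocycleExtension C, inferInstance, ⟨((QuotientGroup.quotientMulEquivOfEq hker).trans
    (QuotientGroup.quotientKerEquivOfSurjective π hπ)).symm⟩⟩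

end CocycleExtension

/-! ### Rank of an elementary abelian group as a dimension -/

section ElementaryAbelianRank

open Module

variable {p : ℕ} [Fact p.Prime] {H M : Type*} [Group H] [Group.FG H] [AddCommGroup M]
  [Module (ZMod p) M]

theorem exists_finset_span_eq_top_of_mulEquiv (e : H ≃* Multiplicative M) :
    ∃ S : Finset M, S.card ≤ Group.rank H ∧ Submodule.span (ZMod p) (S : Set M) = ⊤ := by
  classical
  obtain ⟨S, hS, hcl⟩ := Group.rank_spec H
  refine ⟨S.image fun x => (e x).toAdd, hS ▸ Finset.card_image_le, ?_⟩
  rw [eq_top_iff]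
  intro m _
  obtain ⟨x, rfl⟩ : ∃ x, (e x).toAdd = m := ⟨e.symm (Multiplicative.ofAdd m), by simp⟩
  have hx : x ∈ Subgroup.closure (S : Set H) := by rw [hcl]; trivial
  induction hx using Subgroup.closure_induction with
  | mem x hx =>
    exact Submodule.subset_span (Finset.mem_coe.2 (Finset.mem_image_of_mem _ hx))
  | one => simp
  | mul x y _ _ hx hy => simpa using add_mem (hx trivial) (hy trivial)
  | inv x _ hx => simpa using hx trivial

theorem finite_of_mulEquiv (e : H ≃* Multiplicative M) : Module.Finite (ZMod p) M := by
  obtain ⟨S, -, hS⟩ := exists_finset_span_eq_top_of_mulEquiv (p := p) e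
  exact ⟨S, hS⟩

theorem rank_eq_finrank_of_mulEquiv (e : H ≃* Multiplicative M) :
    Group.rank H = finrank (ZMod p) M := by
  classical
  have := finite_of_mulEquiv (p := p) e
  apply le_antisymm
  · let b := finBasis (ZMod p) M
    let S : Finset H := Finset.univ.image fun i => e.symm (Multiplicative.ofAdd (b i))
    have hS : Subgroup.closure (S : Set H) = ⊤ := by
      let K : AddSubgroup M :=
        { carrier := {m | e.symm (Multiplicative.ofAdd m) ∈ Subgroup.closure (S : Set H)}
          add_mem' := fun ha hb => by simpa using mul_mem ha hb
          zero_mem' := by simp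
          neg_mem' := fun ha => by simpa using ha }
      have hK : AddSubgroup.toZModSubmodule p K = ⊤ := by
        rw [eq_top_iff, ← b.span_eq, Submodule.span_le]
        rintro _ ⟨i, rfl⟩
        exact Subgroup.subset_closure (Finset.mem_coe.2 (Finset.mem_image_of_mem _ (Finset.mem_univ i)))
      rw [eq_top_iff]
      intro x _
      have : (e x).toAdd ∈ AddSubgroup.toZModSubmodule p K := by rw [hK]; trivial
      simpa [K] using (AddSubgroup.mem_toZModSubmodule p).1 this
    refine (Group.rank_le hS).trans (Finset.card_image_le.trans ?_)
    simp
  · obtain ⟨S, hS, hspan⟩ := exists_finset_span_eq_top_of_mulEquiv (p := p) e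
    rw [← finrank_top, ← hspan]
    exact (finrank_span_finset_le_card S).trans hS

end ElementaryAbelianRank

/-! ### Commutators with central values -/

section CommutatorCalculus

open scoped commutatorElement

variable {G : Type*} [Group G]

theorem commutatorElement_mul_left {x y z : G} (h : ⁅y, z⁆ ∈ Subgroup.center G) :
    ⁅x * y, z⁆ = ⁅x, z⁆ * ⁅y, z⁆ := by
  have h1 : ⁅x * y, z⁆ = x * ⁅y, z⁆ * x⁻¹ * ⁅x, z⁆ := by
    simp only [commutatorElement_def]; group
  rw [h1, Subgroup.mem_center_iff.1 h x, mul_inv_cancel_right, Subgroup.mem_center_iff.1 h]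

theorem commutatorElement_mul_right {x y z : G} (h : ⁅x, z⁆ ∈ Subgroup.center G) :
    ⁅x, y * z⁆ = ⁅x, y⁆ * ⁅x, z⁆ := by
  have h1 : ⁅x, y * z⁆ = ⁅x, y⁆ * (y * ⁅x, z⁆ * y⁻¹) := by
    simp only [commutatorElement_def]; group
  rw [h1, Subgroup.mem_center_iff.1 h y, mul_inv_cancel_right]

theorem commutatorElement_eq_one_of_mem_center_left {x : G} (h : x ∈ Subgroup.center G) (y : G) :
    ⁅x, y⁆ = 1 :=
  commutatorElement_eq_one_iff_mul_comm.2 (Subgroup.mem_center_iff.1 h y).symm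

theorem commutatorElement_eq_one_of_mem_center_right {y : G} (h : y ∈ Subgroup.center G) (x : G) :
    ⁅x, y⁆ = 1 :=
  commutatorElement_eq_one_iff_mul_comm.2 (Subgroup.mem_center_iff.1 h x)

end CommutatorCalculus

/-! ### The Baer correspondence for odd p -/

section Baer

open scoped commutatorElement IsMulCommutative

variable {G : Type*} [Group G]

theorem exists_additive_retraction {p : ℕ} [Fact p.Prime] {L Z : Type*} [AddCommGroup L]
    [AddCommGroup Z] [Module (ZMod p) Z] (hL : ∀ x : L, p • x = 0) (ι : Z →+ L)
    (hι : Function.Injective ι) :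
    ∃ r : L → Z, (∀ x y, r (x + y) = r x + r y) ∧ ∀ z, r (ι z) = z := by
  have : Module (ZMod p) L := AddCommGroup.zmodModule hL
  obtain ⟨r, hr⟩ := (ι.toZModLinearMap p).exists_leftInverse_of_injective (LinearMap.ker_eq_bot.2 hι)
  exact ⟨fun x => r x, fun x y => r.map_add x y, fun z => LinearMap.congr_fun hr z⟩

/-- The Baer sum makes a class two group of odd prime exponent `p` a vector space over `ZMod p`;
a linear retraction onto the center is a coordinate `ζ` as follows. -/
theorem exists_baer_retraction {p : ℕ} [hp : Fact p.Prime] (hp2 : p ≠ 2)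
    (hexp : ∀ x : G, x ^ p = 1) (hG : ∀ x y : G, ⁅x, y⁆ ∈ Subgroup.center G)
    [Module (ZMod p) (Additive (Subgroup.center G))] :
    ∃ ζ : G → Additive (Subgroup.center G), (∀ z : Subgroup.center G, ζ z = Additive.ofMul z) ∧
      ∀ x y, ζ (x * y) = ζ x + ζ y + (2 : ZMod p)⁻¹ • Additive.ofMul ⟨⁅x, y⁆, hG x y⟩ := by
  obtain ⟨k, hk⟩ := hp.out.odd_of_ne_two hp2
  -- h = (p + 1)/2 represents 1/2 modulo p.
  set h := k + 1 with hh
  have h2 : h + h = p + 1 := by omega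
  let b : G → G → Subgroup.center G := fun x y => ⟨⁅x, y⁆, hG x y⟩
  have b_mul_left : ∀ x y z, b (x * y) z = b x z * b y z := fun x y z =>
    Subtype.ext (commutatorElement_mul_left (hG _ _))
  have b_mul_right : ∀ x y z, b x (y * z) = b x y * b x z := fun x y z =>
    Subtype.ext (commutatorElement_mul_right (hG _ _))
  have b_center_left : ∀ (z : Subgroup.center G) y, b z y = 1 := fun z y =>
    Subtype.ext (commutatorElement_eq_one_of_mem_center_left z.2 y)
  have b_center_right : ∀ (z : Subgroup.center G) y, b y z = 1 := fun z y =>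
    Subtype.ext (commutatorElement_eq_one_of_mem_center_right z.2 y)
  have b_self : ∀ x, b x x = 1 := fun x => Subtype.ext (commutatorElement_self x)
  have b_swap : ∀ x y, b y x = (b x y)⁻¹ := fun x y => Subtype.ext (commutatorElement_inv x y).symm
  have hpow : ∀ z : Subgroup.center G, z ^ p = 1 := fun z => Subtype.ext (hexp z)
  have hhalf : ∀ z : Subgroup.center G, z ^ h * z ^ h = z := fun z => by
    rw [← pow_add, h2, pow_succ, hpow, one_mul]
  have hcomm : ∀ (z : Subgroup.center G) (x : G), (z : G) * x = x * z := fun z x =>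
    (Subgroup.mem_center_iff.1 z.2 x).symm
  -- Baer's sum x + y = xy[y,x]^(1/2): the half commutator makes the product symmetric without
  -- changing powers or multiplication by central elements.
  let : Add G := ⟨fun x y => x * y * (b y x ^ h : Subgroup.center G)⟩
  let : Zero G := ⟨1⟩
  let : Neg G := ⟨fun x => x⁻¹⟩
  have add_def : ∀ x y : G, x + y = x * y * (b y x ^ h : Subgroup.center G) := fun _ _ => rfl
  have zero_def : (0 : G) = 1 := rfl
  let : AddGroup G := AddGroup.ofLeftAxioms
    (fun x y z => by
      have h1 : x + y + z = x * y * z * (b y x ^ h * b z (x + y) ^ h : Subgroup.center G) := by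
        rw [add_def (x + y), add_def x, mul_assoc (x * y), hcomm, Subgroup.coe_mul]
        simp only [mul_assoc]
      have h2 : x + (y + z) = x * y * z * (b z y ^ h * b (y + z) x ^ h : Subgroup.center G) := by
        rw [add_def x, add_def y, Subgroup.coe_mul]
        simp only [mul_assoc]
      rw [h1, h2, add_def x, add_def y, b_mul_left, b_mul_right, b_center_left, b_center_right,
        b_mul_left, b_mul_right, mul_one, mul_one, mul_pow, mul_pow]
      congr 2
      rw [mul_comm, mul_right_comm, mul_comm, mul_comm (b y x ^ h)])
    (fun x => by rw [add_def, zero_def, one_mul, show b x 1 = 1 from b_center_right 1 x, one_pow,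
      Subgroup.coe_one, mul_one])
    (fun x => by
      rw [add_def]
      change x⁻¹ * x * _ = (1 : G)
      rw [inv_mul_cancel, one_mul]
      have : b x x⁻¹ = 1 := by
        rw [← b_self x, ← mul_left_cancel_iff (a := b x x), ← b_mul_right, mul_inv_cancel, b_self,
          mul_one]
        exact b_center_right 1 x
      change ((b x x⁻¹ ^ h : Subgroup.center G) : G) = 1
      rw [this, one_pow, Subgroup.coe_one])
  let : AddCommGroup G :=
    { (inferInstance : AddGroup G) with
      add_comm := fun x y => by
        have h1 : x * y = y * x * (b x y : Subgroup.center G) := by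
          rw [← hcomm]
          simp only [b, commutatorElement_def]
          group
        rw [add_def, add_def, h1, mul_assoc, ← Subgroup.coe_mul]
        congr 2
        conv_lhs => rw [← hhalf (b x y), b_swap x y, inv_pow, mul_inv_cancel_right] }
  have add_center : ∀ (x : G) (z : Subgroup.center G), x + z = x * z := fun x z => by
    rw [add_def, b_center_left, one_pow, Subgroup.coe_one, mul_one]
  have nsmul_eq : ∀ (n : ℕ) (x : G), n • x = x ^ n := by
    intro n x
    induction n with
    | zero => rw [zero_nsmul, pow_zero, zero_def]
    | succ n ih =>
      have : ∀ n, b x (x ^ n) = 1 := by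
        intro n
        induction n with
        | zero => rw [pow_zero]; exact b_center_right 1 x
        | succ n ih => rw [pow_succ, b_mul_right, ih, b_self, one_mul]
      rw [succ_nsmul, ih, add_def, this, one_pow, Subgroup.coe_one, mul_one, pow_succ]
  let ι : Additive (Subgroup.center G) →+ G := AddMonoidHom.mk' (fun z => (z.toMul : G))
    fun x y => (add_center _ _).symm
  obtain ⟨r, radd, hr⟩ := exists_additive_retraction (p := p)
    (fun x : G => by rw [nsmul_eq, hexp, zero_def]) ι fun x y h => Subtype.ext h
  refine ⟨r, fun z => hr (Additive.ofMul z), fun x y => ?_⟩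
  have hmul : x * y = x + y + ι (h • Additive.ofMul (b x y)) := by
    have h1 : ι (h • Additive.ofMul (b x y)) = ((b x y ^ h : Subgroup.center G) : G) := rfl
    rw [h1, add_center, add_def, mul_assoc, ← Subgroup.coe_mul, b_swap x y, inv_pow, inv_mul_cancel,
      Subgroup.coe_one, mul_one]
  rw [hmul, radd, radd, hr]
  have h3 : (2 : ZMod p)⁻¹ = (h : ℕ) := by
    have h4 : (2 : ZMod p) * (h : ℕ) = 1 := by
      rw [two_mul, ← Nat.cast_add, h2, Nat.cast_add, ZMod.natCast_self, zero_add, Nat.cast_one]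
    exact inv_eq_of_mul_eq_one_right h4
  rw [h3, Nat.cast_smul_eq_nsmul]

end Baer

/-! ### The commutator as an alternating form -/

section CommutatorForm

open Module

/-- A biadditive map between `ZMod p`-modules, as a bilinear map. -/
def bilinOfBiadditive (p : ℕ) {U V M : Type*} [AddCommGroup U] [AddCommGroup V] [AddCommGroup M]
    [Module (ZMod p) U] [Module (ZMod p) V] [Module (ZMod p) M] (f : U → V → M)
    (h1 : ∀ x x' y, f (x + x') y = f x y + f x' y)
    (h2 : ∀ x y y', f x (y + y') = f x y + f x y') : U →ₗ[ZMod p] V →ₗ[ZMod p] M :=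
  (AddMonoidHom.mk' (fun u => (AddMonoidHom.mk' (f u) (h2 u)).toZModLinearMap p)
    fun x x' => LinearMap.ext fun y => h1 x x' y).toZModLinearMap p

open scoped commutatorElement IsMulCommutative

variable {G : Type*} [Group G]

theorem commutatorElement_mem_commutator (x y : G) : ⁅x, y⁆ ∈ commutator G :=
  Subgroup.commutator_mem_commutator trivial trivial

theorem commutatorElement_out_mk (x y : G) :
    ⁅(x : G ⧸ Subgroup.center G).out, (y : G ⧸ Subgroup.center G).out⁆ = ⁅x, y⁆ := by
  have h : ∀ x : G, ∃ c ∈ Subgroup.center G, (x : G ⧸ Subgroup.center G).out = x * c := fun x => by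
    obtain ⟨c, hc⟩ := QuotientGroup.mk_out_eq_mul (Subgroup.center G) x
    exact ⟨c, c.2, hc⟩
  obtain ⟨c, hc, hx⟩ := h x
  obtain ⟨d, hd, hy⟩ := h y
  have hcz := commutatorElement_eq_one_of_mem_center_left hc
  have hdz := commutatorElement_eq_one_of_mem_center_right hd
  rw [hx, hy, commutatorElement_mul_left (by rw [hcz]; exact one_mem _), hcz, mul_one,
    commutatorElement_mul_right (by rw [hdz]; exact one_mem _), hdz, mul_one]

variable {p : ℕ} [IsMulCommutative (G ⧸ Subgroup.center G)] [IsMulCommutative (commutator G)]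
  [Module (ZMod p) (Additive (G ⧸ Subgroup.center G))] [Module (ZMod p) (Additive (commutator G))]

/-- The commutator of a class two group, as a bilinear map on its central quotient. -/
theorem exists_commutatorForm (hG : ∀ x y : G, ⁅x, y⁆ ∈ Subgroup.center G) :
    ∃ β : Additive (G ⧸ Subgroup.center G) →ₗ[ZMod p] Additive (G ⧸ Subgroup.center G) →ₗ[ZMod p]
      Additive (commutator G), ∀ x y : G, β (Additive.ofMul (x : G ⧸ Subgroup.center G))
        (Additive.ofMul (y : G ⧸ Subgroup.center G)) =
          Additive.ofMul ⟨⁅x, y⁆, commutatorElement_mem_commutator x y⟩ := by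
  have ind : ∀ {P : Additive (G ⧸ Subgroup.center G) → Prop},
      (∀ x : G, P (Additive.ofMul (x : G ⧸ Subgroup.center G))) → ∀ u, P u := fun h u =>
    QuotientGroup.induction_on (C := fun u => _) u.toMul h
  let f : Additive (G ⧸ Subgroup.center G) → Additive (G ⧸ Subgroup.center G) →
      Additive (commutator G) := fun u v =>
    Additive.ofMul ⟨⁅u.toMul.out, v.toMul.out⁆, commutatorElement_mem_commutator _ _⟩
  have hf : ∀ x y : G, f (Additive.ofMul (x : G ⧸ Subgroup.center G))
        (Additive.ofMul (y : G ⧸ Subgroup.center G)) =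
          Additive.ofMul ⟨⁅x, y⁆, commutatorElement_mem_commutator x y⟩ := fun x y =>
    congr_arg Additive.ofMul (Subtype.ext (commutatorElement_out_mk x y))
  refine ⟨bilinOfBiadditive p f ?_ ?_, hf⟩
  · intro u u' v
    induction u using ind with | _ x
    induction u' using ind with | _ x'
    induction v using ind with | _ y
    rw [← ofMul_mul, ← QuotientGroup.mk_mul, hf, hf, hf]
    exact congr_arg Additive.ofMul (Subtype.ext (commutatorElement_mul_left (hG _ _)))
  · intro v u u'
    induction u using ind with | _ x
    induction u' using ind with | _ x'
    induction v using ind with | _ y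
    rw [← ofMul_mul, ← QuotientGroup.mk_mul, hf, hf, hf]
    exact congr_arg Additive.ofMul (Subtype.ext (commutatorElement_mul_right (hG _ _)))

variable {β : Additive (G ⧸ Subgroup.center G) →ₗ[ZMod p] Additive (G ⧸ Subgroup.center G)
  →ₗ[ZMod p] Additive (commutator G)}

theorem span_range_commutatorForm
    (hβ : ∀ x y : G, β (Additive.ofMul (x : G ⧸ Subgroup.center G))
      (Additive.ofMul (y : G ⧸ Subgroup.center G)) =
        Additive.ofMul ⟨⁅x, y⁆, commutatorElement_mem_commutator x y⟩) :
    Submodule.span (ZMod p) {w | ∃ u v, β u v = w} = ⊤ := by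
  rw [eq_top_iff]
  rintro w -
  obtain ⟨g, hg⟩ := w
  change Additive.ofMul (⟨g, hg⟩ : commutator G) ∈ _
  have hg' := hg
  rw [commutator_eq_closure] at hg'
  induction hg' using Subgroup.closure_induction with
  | mem g hg' =>
    obtain ⟨x, y, rfl⟩ := hg'
    exact Submodule.subset_span ⟨_, _, hβ x y⟩
  | one => exact zero_mem _
  | mul x y hx hy ihx ihy =>
    rw [← commutator_eq_closure] at hx hy
    exact add_mem (ihx hx) (ihy hy)
  | inv x hx ihx =>
    rw [← commutator_eq_closure] at hx
    exact neg_mem (ihx hx)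

theorem commutatorForm_self
    (hβ : ∀ x y : G, β (Additive.ofMul (x : G ⧸ Subgroup.center G))
      (Additive.ofMul (y : G ⧸ Subgroup.center G)) =
        Additive.ofMul ⟨⁅x, y⁆, commutatorElement_mem_commutator x y⟩)
    (u : Additive (G ⧸ Subgroup.center G)) : β u u = 0 := by
  obtain ⟨x, hx⟩ := QuotientGroup.mk_surjective u.toMul
  have := hβ x x
  rw [hx] at this
  exact this.trans (congr_arg Additive.ofMul (Subtype.ext (commutatorElement_self x)))

theorem commutatorForm_swap
    (hβ : ∀ x y : G, β (Additive.ofMul (x : G ⧸ Subgroup.center G))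
      (Additive.ofMul (y : G ⧸ Subgroup.center G)) =
        Additive.ofMul ⟨⁅x, y⁆, commutatorElement_mem_commutator x y⟩)
    (u v : Additive (G ⧸ Subgroup.center G)) : β u v = -β v u := by
  have h := commutatorForm_self hβ (u + v)
  simp only [map_add, LinearMap.add_apply, commutatorForm_self hβ, zero_add, add_zero] at h
  exact eq_neg_of_add_eq_zero_right h

end CommutatorForm

/-! ### From Jacobi forms to capability -/

section Capable

open Module
open scoped commutatorElement IsMulCommutative

theorem isCapable_of_sq_lt {p : ℕ} [hp : Fact p.Prime] (hp2 : p ≠ 2) {G : Type*} [Group G]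
    (hexp : ∀ x : G, x ^ p = 1) (hG : ∀ x y : G, ⁅x, y⁆ ∈ Subgroup.center G)
    [IsMulCommutative (G ⧸ Subgroup.center G)] [IsMulCommutative (commutator G)]
    [Module (ZMod p) (Additive (G ⧸ Subgroup.center G))] [Module (ZMod p) (Additive (commutator G))]
    [FiniteDimensional (ZMod p) (Additive (G ⧸ Subgroup.center G))]
    [FiniteDimensional (ZMod p) (Additive (commutator G))]
    {k : ℕ} (hk : (finrank (ZMod p) (Additive (G ⧸ Subgroup.center G))).choose 2 ≤
      finrank (ZMod p) (Additive (commutator G)) + k)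
    (hlt : k ^ 2 < 4 * finrank (ZMod p) (Additive (G ⧸ Subgroup.center G))) : IsCapable G := by
  obtain ⟨β, hβ⟩ := exists_commutatorForm (p := p) hG
  have h2 : (2 : ZMod p) ≠ 0 := by
    intro h
    rw [show (2 : ZMod p) = (2 : ℕ) by norm_num, ZMod.natCast_eq_zero_iff] at h
    exact hp2 ((Nat.prime_dvd_prime_iff_eq hp.out Nat.prime_two).1 h)
  have halt := commutatorForm_self hβ
  have hle : commutator G ≤ Subgroup.center G := by
    rw [commutator_eq_closure, Subgroup.closure_le]
    rintro _ ⟨x, y, rfl⟩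
    exact hG x y
  have : Module (ZMod p) (Additive (Subgroup.center G)) :=
    AddCommGroup.zmodModule fun z => congr_arg Additive.ofMul (Subtype.ext (hexp z.toMul.1))
  let inc : Additive (commutator G) →ₗ[ZMod p] Additive (Subgroup.center G) :=
    (MonoidHom.toAdditive (Subgroup.inclusion hle)).toZModLinearMap p
  have hinc : Function.Injective inc := Subgroup.inclusion_injective hle
  obtain ⟨ζ, hζc, hζ⟩ := exists_baer_retraction hp2 hexp hG
  let β' := β.compr₂ inc
  -- Detection must cover all of Z(G). Outside [G,G] the Jacobi identity is automatic: take f ⊗ g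
  -- with f zero on [G,G] and g a nonzero functional on V.
  have hψ : ∀ z : Additive (Subgroup.center G), z ≠ 0 → ∃ ψ, IsJacobi β' ψ ∧ ψ z ≠ 0 := by
    intro z hz
    by_cases hzW : z ∈ LinearMap.range inc
    · obtain ⟨w, rfl⟩ := hzW
      have hw : w ≠ 0 := fun h => hz (by rw [h, map_zero])
      obtain ⟨φ, hφ, hφw⟩ := exists_isJacobi_apply_ne_zero h2 halt (span_range_commutatorForm hβ)
        hk hlt hw
      obtain ⟨r, hr⟩ := inc.exists_leftInverse_of_injective (LinearMap.ker_eq_bot.2 hinc)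
      have hr : ∀ w, r (inc w) = w := LinearMap.congr_fun hr
      refine ⟨φ.comp r, fun x y z => ?_, ?_⟩
      · simpa [β', hr] using hφ x y z
      · simpa [hr] using hφw
    · obtain ⟨f, hf, hfW⟩ := Submodule.exists_le_ker_of_notMem hzW
      have hpos : 0 < finrank (ZMod p) (Additive (G ⧸ Subgroup.center G)) := by
        have := (Nat.zero_le (k ^ 2)).trans_lt hlt
        omega
      have := finrank_pos_iff.1 hpos
      obtain ⟨v, hv⟩ := exists_ne (0 : Additive (G ⧸ Subgroup.center G))
      obtain ⟨g, hg⟩ : ∃ g : Dual (ZMod p) (Additive (G ⧸ Subgroup.center G)), g v ≠ 0 := by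
        by_contra! h
        exact hv ((forall_dual_apply_eq_zero_iff (ZMod p) v).1 h)
      have hf0 : ∀ w, f (inc w) = 0 := fun w => hfW ⟨w, rfl⟩
      refine ⟨f.smulRight g, fun x y z => ?_, fun h => ?_⟩
      · simp [β', hf0]
      · have := LinearMap.congr_fun h v
        simp [hf, hg] at this
  refine isCapable_of_exists_isTwoCocycle (A := ZMod p) fun g hg => ?_
  by_cases hgc : g ∈ Subgroup.center G
  · obtain ⟨ψ, hψJ, hψg⟩ := hψ (Additive.ofMul ⟨g, hgc⟩) fun h => hg (congr_arg Subtype.val h)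
    have hskew : ∀ x y, β' x y = -β' y x := fun x y =>
      (congr_arg inc (commutatorForm_swap hβ x y)).trans (map_neg inc _)
    obtain ⟨q, hq⟩ := exists_coboundaryTwo_eq h2 hskew (φ := (2 : ZMod p)⁻¹ • ψ) fun x y z => by
      simpa [← mul_add] using Or.inr (hψJ x y z)
    let v : G → Additive (G ⧸ Subgroup.center G) := fun x => Additive.ofMul x
    have hv : ∀ x y, v (x * y) = v x + v y := fun _ _ => rfl
    -- The term ψ(ζ x, y) fails the cocycle identity by ½ψ([x,y],z), because ζ is additive only up
    -- to half a commutator; `q` repairs this.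
    refine ⟨fun x y => ψ (ζ x) (v y) + q (v x) (v y), fun x y z => ?_, ?_⟩
    · have h1 := hq (v x) (v y) (v z)
      have h3 : Additive.ofMul (⟨⁅x, y⁆, hG x y⟩ : Subgroup.center G) = β' (v x) (v y) :=
        (congr_arg inc (hβ x y)).symm
      simp only [hζ, hv, map_add, LinearMap.add_apply, h3, map_smul, LinearMap.smul_apply] at h1 ⊢
      linear_combination h1
    · obtain ⟨u, hu⟩ : ∃ u, ψ (Additive.ofMul ⟨g, hgc⟩) u ≠ 0 := by
        by_contra! h
        exact hψg (LinearMap.ext h)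
      obtain ⟨x, hx⟩ := QuotientGroup.mk_surjective u.toMul
      have hx : v x = u := hx
      have hg0 : v g = 0 := congr_arg Additive.ofMul ((QuotientGroup.eq_one_iff g).2 hgc)
      -- These give q(0,u) = q(0,0) = q(u,0), so the correction drops out of c(g,x) - c(x,g),
      -- leaving ψ(g,u).
      have h1 := hq 0 0 u
      have h3 := hq u 0 0
      refine ⟨x, Or.inr fun h => hu ?_⟩
      have h4 := hζc ⟨g, hgc⟩
      simp only [hg0, hx, h4, map_zero, LinearMap.zero_apply, add_zero, zero_add] at h h1 h3
      linear_combination h + h1 + h3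
  · refine ⟨0, fun x y z => by simp, ?_⟩
    rw [Subgroup.mem_center_iff] at hgc
    push Not at hgc
    obtain ⟨x, hx⟩ := hgc
    exact ⟨x, Or.inl hx.symm⟩

end Capable

/-! ### Hall–Witt in class three -/

section ClassThree

open scoped commutatorElement IsMulCommutative

variable {K : Type*} [Group K]

/-- The map k ↦ ⁅x, k⁆ is a homomorphism into the abelian group Z(K), so it kills commutators. -/
theorem commutatorElement_commutatorElement_right_eq_one {x : K}
    (hx : ∀ k : K, ⁅x, k⁆ ∈ Subgroup.center K) (a b : K) : ⁅x, ⁅a, b⁆⁆ = 1 := by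
  let f : K →* Subgroup.center K := MonoidHom.mk' (fun k => ⟨⁅x, k⁆, hx k⟩) fun k k' =>
    Subtype.ext (commutatorElement_mul_right (hx k'))
  have h : f ⁅a, b⁆ = 1 := by
    rw [map_commutatorElement, commutatorElement_eq_one_iff_mul_comm]
    exact mul_comm _ _
  exact congr_arg Subtype.val h

/-- The Hall–Witt identity in a group of class three. -/
theorem hallWitt_of_mem_center (hK : ∀ a b c : K, ⁅⁅a, b⁆, c⁆ ∈ Subgroup.center K) (a b c : K) :
    ⁅⁅a, b⁆, c⁆ * ⁅⁅b, c⁆, a⁆ * ⁅⁅c, a⁆, b⁆ = 1 := by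
  have hK' : ∀ a b c : K, ⁅c, ⁅a, b⁆⁆ ∈ Subgroup.center K := fun a b c => by
    rw [← commutatorElement_inv]; exact inv_mem (hK a b c)
  have hcomm : ∀ a b c d : K, ⁅⁅a, b⁆, ⁅c, d⁆⁆ = 1 := fun a b c d =>
    commutatorElement_commutatorElement_right_eq_one (hK a b) c d
  -- Conjugate each entry by c, then expand; commutators commute with one another, so few factors
  -- survive.
  have h1 : c * ⁅a, b⁆ * c⁻¹ = ⁅⁅c, a⁆ * a, ⁅c, b⁆ * b⁆ := by
    simp only [commutatorElement_def]; group
  have h2 : ∀ z : K, ⁅⁅c, a⁆, ⁅c, b⁆ * z⁆ = ⁅⁅c, a⁆, z⁆ := fun z => by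
    rw [commutatorElement_mul_right (hK c a z), hcomm, one_mul]
  have h3 : ∀ x y z : K, ⁅x * y, z⁆ = x * ⁅y, z⁆ * x⁻¹ * ⁅x, z⁆ := fun x y z => by
    simp only [commutatorElement_def]; group
  have h4 : ∀ x y z : K, ⁅x, y * z⁆ = ⁅x, y⁆ * (y * ⁅x, z⁆ * y⁻¹) := fun x y z => by
    simp only [commutatorElement_def]; group
  have hc : ∀ a b c d : K, ⁅a, b⁆ * ⁅c, d⁆ * ⁅a, b⁆⁻¹ = ⁅c, d⁆ := fun a b c d => by
    rw [commutatorElement_eq_one_iff_mul_comm.1 (hcomm a b c d), mul_inv_cancel_right]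
  rw [h3, hc, h2, h4, hc] at h1
  have h5 : ⁅c, ⁅a, b⁆⁆ = c * ⁅a, b⁆ * c⁻¹ * ⁅a, b⁆⁻¹ := by
    simp only [commutatorElement_def]
  have h6 : ⁅c, ⁅a, b⁆⁆ = ⁅a, ⁅c, b⁆⁆ * ⁅⁅c, a⁆, b⁆ := by
    rw [h5, h1, mul_assoc, mul_assoc, ← mul_assoc ⁅a, b⁆, Subgroup.mem_center_iff.1 (hK c a b),
      mul_inv_cancel_right]
  have h7 : ⁅a, ⁅c, b⁆⁆ = ⁅⁅b, c⁆, a⁆ := by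
    have h8 := commutatorElement_mul_right (x := a) (y := ⁅b, c⁆) (hK' c b a)
    rw [← commutatorElement_inv b c, mul_inv_cancel, commutatorElement_one_right] at h8
    rw [← commutatorElement_inv b c, ← commutatorElement_inv a ⁅b, c⁆]
    exact eq_inv_of_mul_eq_one_right h8.symm
  rw [mul_assoc, ← h7, ← h6, ← commutatorElement_inv, inv_mul_cancel]

end ClassThree

/-! ### From K/Z(K) to Jacobi forms -/

section CentralQuotient

open Module
open scoped commutatorElement IsMulCommutative

variable {p : ℕ} [hp : Fact p.Prime] {G K : Type*} [Group G] [Group K]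
  [IsMulCommutative (G ⧸ Subgroup.center G)] [IsMulCommutative (commutator G)]
  [Module (ZMod p) (Additive (G ⧸ Subgroup.center G))] [Module (ZMod p) (Additive (commutator G))]
  {β : Additive (G ⧸ Subgroup.center G) →ₗ[ZMod p] Additive (G ⧸ Subgroup.center G)
    →ₗ[ZMod p] Additive (commutator G)}

theorem exists_isJacobi_of_mulEquiv (hexp : ∀ x : G, x ^ p = 1)
    (hG : ∀ x y : G, ⁅x, y⁆ ∈ Subgroup.center G)
    (hβ : ∀ x y : G, β (Additive.ofMul (x : G ⧸ Subgroup.center G))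
      (Additive.ofMul (y : G ⧸ Subgroup.center G)) =
        Additive.ofMul ⟨⁅x, y⁆, commutatorElement_mem_commutator x y⟩)
    (e : G ≃* K ⧸ Subgroup.center K) (w : Additive (commutator G)) (hw : w ≠ 0) :
    ∃ φ, IsJacobi β φ ∧ φ w ≠ 0 := by
  have hle : commutator G ≤ Subgroup.center G := by
    rw [commutator_eq_closure, Subgroup.closure_le]
    rintro _ ⟨x, y, rfl⟩
    exact hG x y
  let t : G → K := fun g => (e g).out
  have mk_t : ∀ g, (t g : K ⧸ Subgroup.center K) = e g := fun g => QuotientGroup.out_eq' _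
  have left_congr : ∀ {x y : K}, (x : K ⧸ Subgroup.center K) = y → ∀ z : K, ⁅x, z⁆ = ⁅y, z⁆ := by
    intro x y h z
    have hc := commutatorElement_eq_one_of_mem_center_left (QuotientGroup.eq.1 h) z
    rw [← mul_inv_cancel_left x y, commutatorElement_mul_left (by rw [hc]; exact one_mem _), hc,
      mul_one]
  have right_congr : ∀ {x y : K}, (x : K ⧸ Subgroup.center K) = y → ∀ z : K, ⁅z, x⁆ = ⁅z, y⁆ :=
    fun h z => by rw [← commutatorElement_inv, left_congr h, commutatorElement_inv]
  let C : G → G → K := fun g h => ⁅t g, t h⁆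
  have mk_C : ∀ g h, (C g h : K ⧸ Subgroup.center K) = e ⁅g, h⁆ := fun g h => by
    rw [map_commutatorElement, ← mk_t, ← mk_t]; rfl
  have C_mem : ∀ {g h}, ⁅g, h⁆ = 1 → C g h ∈ Subgroup.center K := fun {g h} hgh => by
    rw [← QuotientGroup.eq_one_iff, mk_C, hgh, map_one]
  have C_one_left : ∀ h, C 1 h = 1 := fun h =>
    commutatorElement_eq_one_of_mem_center_left
      ((QuotientGroup.eq_one_iff _).1 ((mk_t 1).trans (map_one e))) _
  have C_mul_left : ∀ g g' h, ⁅g', h⁆ = 1 → C (g * g') h = C g h * C g' h := fun g g' h hh => by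
    have h1 : (t (g * g') : K ⧸ Subgroup.center K) = (t g * t g' : K) := by
      rw [QuotientGroup.mk_mul, mk_t, mk_t, mk_t, map_mul]
    exact (left_congr h1 _).trans (commutatorElement_mul_left (C_mem hh))
  have C_mul_right : ∀ g h h', ⁅g, h'⁆ = 1 → C g (h * h') = C g h * C g h' := fun g h h' hh => by
    have h1 : (t (h * h') : K ⧸ Subgroup.center K) = (t h * t h' : K) := by
      rw [QuotientGroup.mk_mul, mk_t, mk_t, mk_t, map_mul]
    exact (right_congr h1 _).trans (commutatorElement_mul_right (C_mem hh))
  have comm_one : ∀ {g : G}, g ∈ commutator G → ∀ h : G, ⁅g, h⁆ = 1 := fun hg h =>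
    commutatorElement_eq_one_of_mem_center_left (hle hg) h
  have C_comm : ∀ a b c, C ⁅a, b⁆ c = ⁅⁅t a, t b⁆, t c⁆ := fun a b c =>
    left_congr ((mk_t _).trans (mk_C a b).symm) _
  have t_surj : ∀ a : K, ∃ g, (t g : K ⧸ Subgroup.center K) = a := fun a =>
    ⟨e.symm a, by rw [mk_t, MulEquiv.apply_symm_apply]⟩
  have hK : ∀ a b c : K, ⁅⁅a, b⁆, c⁆ ∈ Subgroup.center K := by
    intro a b c
    obtain ⟨x, hx⟩ := t_surj a
    obtain ⟨y, hy⟩ := t_surj b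
    obtain ⟨z, hz⟩ := t_surj c
    rw [← right_congr hz, ← left_congr (show ((⁅t x, t y⁆ : K) : K ⧸ Subgroup.center K) = ⁅a, b⁆ by
      rw [left_congr hx, right_congr hy]), ← C_comm]
    exact C_mem (comm_one (commutatorElement_mem_commutator x y) z)
  have C_jacobi : ∀ a b c, C ⁅a, b⁆ c * C ⁅b, c⁆ a * C ⁅c, a⁆ b = 1 := fun a b c => by
    rw [C_comm, C_comm, C_comm]
    exact hallWitt_of_mem_center hK _ _ _
  -- For g = ⁅x, y⁆ and z central, two of the three Hall–Witt factors are trivial, hence so is the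
  -- third. The pairing thus descends to G/Z(G) in its second argument.
  have C_center : ∀ g ∈ commutator G, ∀ z ∈ Subgroup.center G, C g z = 1 := by
    intro g hg z hz
    rw [commutator_eq_closure] at hg
    induction hg using Subgroup.closure_induction with
    | mem g hg =>
      obtain ⟨x, y, rfl⟩ := hg
      have h := C_jacobi x y z
      rwa [commutatorElement_eq_one_of_mem_center_right hz,
        commutatorElement_eq_one_of_mem_center_left hz, C_one_left, C_one_left, mul_one,
        mul_one] at h
    | one => exact C_one_left z
    | mul x y _ _ hx hy =>
      rw [C_mul_left _ _ _ (commutatorElement_eq_one_of_mem_center_right hz y), hx, hy, one_mul]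
    | inv x _ hx =>
      have h := C_mul_left x⁻¹ x z (commutatorElement_eq_one_of_mem_center_right hz x)
      rwa [inv_mul_cancel, C_one_left, hx, mul_one, eq_comm] at h
  have C_congr : ∀ g ∈ commutator G, ∀ {x y : G}, (x : G ⧸ Subgroup.center G) = y →
      C g x = C g y := by
    intro g hg x y h
    rw [← mul_inv_cancel_left x y, C_mul_right _ _ _ (comm_one hg _),
      C_center g hg _ (QuotientGroup.eq.1 h), mul_one]
  have C_pow : ∀ g ∈ commutator G, ∀ h n, C (g ^ n) h = C g h ^ n := by
    intro g hg h n
    induction n with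
    | zero => rw [pow_zero, pow_zero, C_one_left]
    | succ n ih => rw [pow_succ, C_mul_left _ _ _ (comm_one hg h), ih, pow_succ]
  -- Z(K) need not have exponent p, but C(g,h)^p = C(g^p,h) = 1, so the values lie in an F-vector
  -- space.
  let A := AddSubgroup.torsionBy (Additive (Subgroup.center K)) p
  let γ₀ : Additive (commutator G) → Additive (G ⧸ Subgroup.center G) → A := fun w u =>
    ⟨Additive.ofMul ⟨C w.toMul u.toMul.out, C_mem (comm_one w.toMul.2 _)⟩, by
      rw [AddSubgroup.torsionBy.nsmul_iff, ← ofMul_pow]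
      refine congr_arg Additive.ofMul (Subtype.ext ?_)
      exact (C_pow _ w.toMul.2 _ p).symm.trans (by rw [hexp, C_one_left]; rfl)⟩
  have γ₀_ext : ∀ {a b : A}, ((a : Additive (Subgroup.center K)).toMul : K) =
      (b : Additive (Subgroup.center K)).toMul → a = b := fun h => Subtype.ext (Subtype.ext h)
  have : Module (ZMod p) A := AddSubgroup.torsionBy.zmodModule
  let γ : Additive (commutator G) →ₗ[ZMod p] Additive (G ⧸ Subgroup.center G) →ₗ[ZMod p] A :=
    bilinOfBiadditive p γ₀
      (fun w w' u => γ₀_ext (C_mul_left _ _ _ (comm_one w'.toMul.2 _)))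
      (fun w u u' => γ₀_ext <| by
        refine (C_congr _ w.toMul.2 ?_).trans (C_mul_right w.toMul u.toMul.out u'.toMul.out
          (comm_one w.toMul.2 _))
        rw [QuotientGroup.out_eq', QuotientGroup.mk_mul, QuotientGroup.out_eq',
          QuotientGroup.out_eq']
        rfl)
  have γ_apply : ∀ w : commutator G, ∀ x : G,
      (((γ (Additive.ofMul w) (Additive.ofMul (x : G ⧸ Subgroup.center G)) : A) :
        Additive (Subgroup.center K)).toMul : K) = C w x := fun w x =>
    C_congr _ w.2 (QuotientGroup.out_eq' _)
  have γ_jacobi : ∀ x y z, γ (β x y) z + γ (β y z) x + γ (β z x) y = 0 := by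
    intro x y z
    obtain ⟨a, ha⟩ := QuotientGroup.mk_surjective x.toMul
    obtain ⟨b, hb⟩ := QuotientGroup.mk_surjective y.toMul
    obtain ⟨c, hc⟩ := QuotientGroup.mk_surjective z.toMul
    have ha : x = Additive.ofMul (a : G ⧸ Subgroup.center G) := ha.symm
    have hb : y = Additive.ofMul (b : G ⧸ Subgroup.center G) := hb.symm
    have hc : z = Additive.ofMul (c : G ⧸ Subgroup.center G) := hc.symm
    rw [ha, hb, hc, hβ, hβ, hβ]
    refine γ₀_ext ((congr_arg₂ _ (congr_arg₂ _ (γ_apply _ _) (γ_apply _ _)) (γ_apply _ _)).trans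
      (C_jacobi a b c))
  -- Otherwise the lift of w would commute with all of K, making w trivial in K/Z(K).
  obtain ⟨u, hu⟩ : ∃ u, γ w u ≠ 0 := by
    by_contra! h
    apply hw
    have h1 : ∀ x, C w.toMul x = 1 := fun x => by
      rw [← γ_apply]
      exact congr_arg (fun a : A => ((a : Additive (Subgroup.center K)).toMul : K)) (h _)
    have h2 : t w.toMul ∈ Subgroup.center K := by
      rw [Subgroup.mem_center_iff]
      intro k
      obtain ⟨x, hx⟩ := t_surj k
      exact (commutatorElement_eq_one_iff_mul_comm.1 ((right_congr hx _).symm.trans (h1 x))).symm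
    rw [← QuotientGroup.eq_one_iff, mk_t, MulEquiv.map_eq_one_iff] at h2
    exact congr_arg Additive.ofMul (Subtype.ext h2)
  obtain ⟨l, hl⟩ : ∃ l : Dual (ZMod p) A, l (γ w u) ≠ 0 := by
    by_contra! h
    exact hu ((forall_dual_apply_eq_zero_iff (ZMod p) _).1 h)
  refine ⟨γ.compr₂ l, fun x y z => ?_, fun h => hl (LinearMap.congr_fun h u)⟩
  rw [← map_zero l, ← γ_jacobi x y z, map_add, map_add]
  rfl

end CentralQuotient

/-! ### Numerical bounds and the main theorem -/

theorem heinekenNikolova_real_bound {n l : ℕ} (h : n ≤ l + (l + 1).choose 2) :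
    (l : ℝ) ≥ (Real.sqrt (9 + 8 * (n : ℝ)) - 3) / 2 := by
  have h1 : (n : ℝ) ≤ l + (l + 1) * l / 2 := by
    have h2 : (n : ℝ) ≤ l + ((l + 1).choose 2 : ℕ) := by exact_mod_cast h
    rw [Nat.cast_choose_two] at h2
    push_cast at h2
    linarith
  -- The inequality `h1` amounts to 9 + 8n ≤ (2l + 3)².
  have h3 : Real.sqrt (9 + 8 * (n : ℝ)) ≤ 2 * l + 3 :=
    Real.sqrt_le_iff.2 ⟨by positivity, by nlinarith⟩
  linarith

theorem sq_choose_two_sub_lt {n l : ℕ} (hn : 0 < n)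
    (h : (l : ℝ) > (n.choose 2 : ℝ) - 2 * Real.sqrt (n : ℝ)) : (n.choose 2 - l) ^ 2 < 4 * n := by
  rcases le_total (n.choose 2) l with hl | hl
  · rw [Nat.sub_eq_zero_of_le hl]
    omega
  · have h1 : (0 : ℝ) ≤ (n.choose 2 : ℝ) - l := sub_nonneg.2 (by exact_mod_cast hl)
    have h2 : (n.choose 2 : ℝ) - l < 2 * Real.sqrt (n : ℝ) := by linarith
    have h3 := Real.sq_sqrt (Nat.cast_nonneg (α := ℝ) n)
    have h4 : ((n.choose 2 : ℝ) - l) ^ 2 < 4 * n := by nlinarith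
    rw [← Nat.cast_sub hl] at h4
    exact_mod_cast h4

open scoped commutatorElement in
theorem commutatorElement_mem_center_of_nilpotencyClass_le_two {G : Type*} [Group G]
    [Group.IsNilpotent G] (h : Group.nilpotencyClass G ≤ 2) (x y : G) :
    ⁅x, y⁆ ∈ Subgroup.center G := by
  have h2 := Subgroup.lowerCentralSeries_eq_bot_iff_nilpotencyClass_le.2 h
  rw [Subgroup.mem_center_iff]
  intro z
  have h3 : ⁅⁅x, y⁆, z⁆ ∈ (⊤ : Subgroup G).lowerCentralSeries 2 :=
    Subgroup.commutator_mem_commutator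
      (Subgroup.commutator_mem_commutator (Subgroup.mem_top x) (Subgroup.mem_top y))
      (Subgroup.mem_top z)
  rw [h2, Subgroup.mem_bot, commutatorElement_eq_one_iff_mul_comm] at h3
  exact h3.symm

open Module in
open scoped commutatorElement IsMulCommutative in
theorem mainTheorem8 (p : ℕ) (hp : p.Prime) (G : Type*) [Group G]
    (hcyc : ¬ IsCyclic G) (hexp : Monoid.exponent G = p)
    [Group.IsNilpotent G] (hclass : Group.nilpotencyClass G ≤ 2)
    [Group.FG (G ⧸ Subgroup.center G)] [Group.FG (commutator G)]
    (n l : ℕ) (hn : Group.rank (G ⧸ Subgroup.center G) = n)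
    (hl : Group.rank (commutator G) = l) :
    (IsCapable G → (l : ℝ) ≥ (Real.sqrt (9 + 8 * (n : ℝ)) - 3) / 2) ∧
      ((l : ℝ) > (n.choose 2 : ℝ) - 2 * Real.sqrt (n : ℝ) → IsCapable G) := by
  have : Fact p.Prime := ⟨hp⟩
  have hpow : ∀ x : G, x ^ p = 1 := fun x => hexp ▸ Monoid.pow_exponent_eq_one x
  have hG : ∀ x y : G, ⁅x, y⁆ ∈ Subgroup.center G :=
    commutatorElement_mem_center_of_nilpotencyClass_le_two hclass
  have hle : commutator G ≤ Subgroup.center G := by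
    rw [commutator_eq_closure, Subgroup.closure_le]
    rintro _ ⟨x, y, rfl⟩
    exact hG x y
  have : IsMulCommutative (commutator G) :=
    ⟨⟨fun a b => Subtype.ext (Subgroup.mem_center_iff.1 (hle b.2) a)⟩⟩
  have : IsMulCommutative (G ⧸ Subgroup.center G) := ⟨⟨fun a b => by
    induction a using QuotientGroup.induction_on with | _ a
    induction b using QuotientGroup.induction_on with | _ b
    rw [← commutatorElement_eq_one_iff_mul_comm]
    exact (QuotientGroup.eq_one_iff _).2 (hG a b)⟩⟩
  have : Module (ZMod p) (Additive (G ⧸ Subgroup.center G)) :=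
    AddCommGroup.zmodModule fun u => by
      induction u using Additive.rec with | _ u
      induction u using QuotientGroup.induction_on with | _ a
      exact congr_arg (fun a : G => Additive.ofMul (a : G ⧸ Subgroup.center G)) (hpow a)
  have : Module (ZMod p) (Additive (commutator G)) :=
    AddCommGroup.zmodModule fun w => congr_arg Additive.ofMul (Subtype.ext (hpow w.toMul.1))
  let eV : G ⧸ Subgroup.center G ≃* Multiplicative (Additive (G ⧸ Subgroup.center G)) :=
    MulEquiv.refl _
  let eW : commutator G ≃* Multiplicative (Additive (commutator G)) := MulEquiv.refl _
  have := finite_of_mulEquiv (p := p) eV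
  have := finite_of_mulEquiv (p := p) eW
  obtain ⟨β, hβ⟩ := exists_commutatorForm (p := p) hG
  rw [rank_eq_finrank_of_mulEquiv (p := p) eV] at hn
  rw [rank_eq_finrank_of_mulEquiv (p := p) eW] at hl
  constructor
  · rintro ⟨K, _, ⟨e⟩⟩
    apply heinekenNikolova_real_bound
    rw [← hn, ← hl]
    refine finrank_le_of_forall_exists_isJacobi (commutatorForm_swap hβ) (fun u hu => ?_)
      (exists_isJacobi_of_mulEquiv hpow hG hβ e)
    obtain ⟨x, hx⟩ := QuotientGroup.mk_surjective u.toMul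
    have hx : u = Additive.ofMul (x : G ⧸ Subgroup.center G) := hx.symm
    rw [hx]
    refine congr_arg Additive.ofMul ((QuotientGroup.eq_one_iff x).2 ?_)
    rw [Subgroup.mem_center_iff]
    intro y
    have h := hu (Additive.ofMul (y : G ⧸ Subgroup.center G))
    rw [hx, hβ] at h
    exact (commutatorElement_eq_one_iff_mul_comm.1 (congr_arg Subtype.val h)).symm
  · intro hnl
    -- If n = 0 then l = 0, and the strict inequality would read 0 > 0.
    have hn0 : 0 < n := by
      by_contra h
      obtain rfl : n = 0 := by omega
      have hV := finrank_zero_iff.1 hn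
      have hW := span_range_commutatorForm hβ
      have h0 : {w | ∃ u v, β u v = w} ⊆ {0} := by
        rintro _ ⟨u, v, rfl⟩
        rw [Subsingleton.elim u 0, map_zero]
        rfl
      have h1 := Submodule.span_mono (R := ZMod p) h0
      rw [hW, Submodule.span_zero_singleton, top_le_iff] at h1
      rw [← finrank_top, ← h1, finrank_bot] at hl
      simp [← hl] at hnl
    -- Exponent 2 makes G abelian, which would give n = 0.
    have hp2 : p ≠ 2 := by
      rintro rfl
      have : Subsingleton (Additive (G ⧸ Subgroup.center G)) := by
        refine ⟨fun u v => ?_⟩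
        have h0 : ∀ u : G ⧸ Subgroup.center G, u = 1 := fun u => by
          induction u using QuotientGroup.induction_on with | _ x
          exact (QuotientGroup.eq_one_iff x).2
            (Subgroup.mem_center_iff.2 fun y => mul_comm_of_exponent_two hexp y x)
        exact congr_arg Additive.ofMul ((h0 u.toMul).trans (h0 v.toMul).symm)
      rw [finrank_zero_of_subsingleton] at hn
      omega
    refine isCapable_of_sq_lt hp2 hpow hG (k := n.choose 2 - l) ?_ ?_
    · rw [hn, hl]; omega
    · rw [hn]; exact sq_choose_two_sub_lt hn0 hnl
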